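/- Let $n$ be a non-negative integer and $[-n,n]=\{-n,\dots,-1,0,1,\dots,n\}$. Let $\mathfrak S^B_n$ be the hyperoctahedral group of permutations $\sigma$ of $[-n,n]$ with $\sigma(-i)=-\sigma(i)$ for all $i$ (so $\sigma(0)=0$); write $\sigma=[w_1,\dots,w_n]$ if $\sigma(i)=w_i$ for $1\le i\le n$. It is generated by $s_0=[-1,2,\dots,n]$ and $s_i=[1,\dots,i-1,i+1,i,i+2,\dots,n]$ $(1\le i\le n-1)$; let $\ell$ be the word length in these generators. The right weak Bruhat order $\preceq_R$ is the partial order whose covering relations are $w\prec ws_i$ for those $i$ with $\ell(ws_i)\not<\ell(w)$, and for $u\preceq_R w$ put $[u,w]_R=\{v: u\preceq_R v\preceq_R w\}$. A $B_n$ poset is a partial order $\preceq_P$ on $[-n,n]$ such that $i\preceq_P j$ if and only if $-j\preceq_P -i$. It is distinguished if, whenever $x$ and $-x$ are comparable in $P$, both $x$ and $-x$ are comparable to $0$. It is regular if it is distinguished and, for all integers $x<y<z$ in $[-n,n]$, $x\prec_P z$ implies $x\prec_P y$ or $y\prec_P z$, and $z\prec_P x$ implies $z\prec_P y$ or $y\prec_P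 x$. For $\gamma\in\mathfrak S^B_n$, let $L_\gamma$ be the linear $B_n$ poset $\gamma(-n)\prec\gamma(-n+1)\prec\cdots\prec\gamma(n)$. A type-$B$ linear extension of $P$ is a linear extension of $P$ that is itself a $B_n$ poset, and $\Sigma^B_R(P)$ is the set of $\gamma\in\mathfrak S^B_n$ such that $L_\gamma$ is a type-$B$ linear extension of $P$. For nonempty $U\subseteq\mathfrak S^B_n$, $\mathrm{poset}(U)$ is the $B_n$ poset whose order relation is $\bigcap_{\sigma\in U}\preceq_{L_\sigma}$. For a regular $B_n$ poset $P$, let $$Q_1=\{x: 0\prec_P x\}\cup\{x>0: x \text{ is incomparable to } 0 \text{ in } P\},\qquad Q_2=\{x: 0\prec_P x\}\cup\{x<0: x \text{ is incomparable to } 0 \text{ in } P\}.$$ For $k=1,\dots,n$ in turn, let $a_k$ be the smallest integer among the $\preceq_P$-minimal elements of $Q_1\setminus\{a_1,\dots,a_{k-1}\}$, and let $b_k$ be the largest integer among the $\preceq_P$-minimal elements of $Q_2\setminus\{b_1,\dots,b_{k-1}\}$. Put $\sigma_P=[a_1,\dots,a_n]$ and $\rho_P=[b_1,\dots,b_n]$,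 which are elements of $\mathfrak S^B_n$. Theorem. (1) For every regular $B_n$ poset $P$, one has $\sigma_P\preceq_R\rho_P$ and $\Sigma^B_R(P)=[\sigma_P,\rho_P]_R$. (2) For all $\sigma,\rho\in\mathfrak S^B_n$ with $\sigma\preceq_R\rho$, the $B_n$ poset $\mathrm{poset}(\{\sigma,\rho\})$ is regular and $\Sigma^B_R(\mathrm{poset}(\{\sigma,\rho\}))=[\sigma,\rho]_R$. -/

import Mathlib

namespace TypeB

/-- The set `[-n, n]` of integers `x` with `-n ≤ x ≤ n`, with its usual linear order. -/
abbrev SInt (n : ℕ) : Type := Set.Icc (-(n : ℤ)) (n : ℤ)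

instance instNegSInt (n : ℕ) : Neg (SInt n) :=
  ⟨fun x => ⟨-x.1, neg_le_neg x.2.2, neg_le.mp x.2.1⟩⟩

instance instZeroSInt (n : ℕ) : Zero (SInt n) :=
  ⟨⟨0, neg_nonpos.mpr (Int.natCast_nonneg n), Int.natCast_nonneg n⟩⟩

/-- The integer `i`, for `i ≤ n`, as an element of `[-n, n]`. -/
def nat {n : ℕ} (i : ℕ) (hi : i ≤ n) : SInt n :=
  ⟨(i : ℤ), by constructor <;> omega⟩

theorem coe_neg {n : ℕ} (x : SInt n) : ((-x : SInt n) : ℤ) = -(x : ℤ) := rfl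

theorem coe_zero {n : ℕ} : ((0 : SInt n) : ℤ) = 0 := rfl

theorem coe_nat {n : ℕ} (i : ℕ) (hi : i ≤ n) : ((nat i hi : SInt n) : ℤ) = i := rfl

theorem neg_neg' {n : ℕ} (x : SInt n) : -(-x) = x :=
  Subtype.ext (by simp [coe_neg])

theorem neg_inj' {n : ℕ} {x y : SInt n} : -x = -y ↔ x = y :=
  ⟨fun h => by rw [← neg_neg' x, h, neg_neg'], fun h => by rw [h]⟩

theorem neg_le_neg_iff' {n : ℕ} {x y : SInt n} : -y ≤ -x ↔ x ≤ y := by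
  rw [← Subtype.coe_le_coe, ← Subtype.coe_le_coe, coe_neg, coe_neg]
  exact neg_le_neg_iff

/-! ### Signed permutations -/

/-- The hyperoctahedral group of signed permutations of `[n]`, regarded as permutations of
`[-n, n]`; the condition forces `σ 0 = 0`. -/
def SignedPerm (n : ℕ) : Subgroup (Equiv.Perm (SInt n)) where
  carrier := {σ | ∀ x, σ (-x) = -σ x}
  one_mem' := fun _ => rfl
  mul_mem' := by
    intro σ τ hσ hτ x
    rw [Equiv.Perm.mul_apply, hτ, hσ, Equiv.Perm.mul_apply]
  inv_mem' := by
    intro σ hσ x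
    rw [Equiv.Perm.inv_eq_iff_eq, hσ]
    exact congrArg _ (σ.apply_symm_apply x).symm

theorem swap_neg {n : ℕ} (a b x : SInt n) :
    Equiv.swap (-a) (-b) (-x) = -(Equiv.swap a b x) := by
  simp only [Equiv.swap_apply_def, neg_inj']
  split_ifs <;> rfl

/-- The simple generators: `s 0` exchanges `1` and `-1`; for `1 ≤ i ≤ n - 1`, `s i` exchanges
`i` and `i + 1`, and `-i` and `-(i + 1)`. -/
def simpleRefl {n : ℕ} (i : Fin n) : SignedPerm n :=
  if h : i.val = 0 then
    ⟨Equiv.swap (nat 1 (by omega)) (-nat 1 (by omega)), by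
      intro x
      have := swap_neg (-nat 1 (by omega)) (nat 1 (by omega)) x
      rwa [neg_neg', Equiv.swap_comm (-nat 1 _)] at this⟩
  else
    ⟨Equiv.swap (nat i.val (by omega)) (nat (i.val + 1) (by omega)) *
        Equiv.swap (-nat i.val (by omega)) (-nat (i.val + 1) (by omega)), by
      intro x
      set a : SInt n := nat i.val (by omega) with ha
      set b : SInt n := nat (i.val + 1) (by omega) with hb
      have hcomm : Equiv.swap a b * Equiv.swap (-a) (-b)
          = Equiv.swap (-a) (-b) * Equiv.swap a b := by
        have h1 : Disjoint ({a, b} : Set (SInt n)) {-a, -b} := by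
          rw [Set.disjoint_left]
          rintro y (rfl | rfl) (h2 | h2) <;>
            · have h3 := congrArg (Subtype.val) h2
              simp only [ha, hb, coe_neg, coe_nat] at h3
              omega
        have h2 : (Equiv.swap a b).Disjoint (Equiv.swap (-a) (-b)) := by
          intro y
          rw [Set.disjoint_left] at h1
          have h3 := @h1 y
          simp only [Set.mem_insert_iff, Set.mem_singleton_iff] at h3
          by_cases hy : y = a ∨ y = b
          · right
            exact Equiv.swap_apply_of_ne_of_ne (fun h => h3 hy (Or.inl h))
              (fun h => h3 hy (Or.inr h))
          · left
            exact Equiv.swap_apply_of_ne_of_ne (fun h => hy (Or.inl h)) (fun h => hy (Or.inr h))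
        exact h2.commute
      have e1 := swap_neg a b
      have e2 := swap_neg (-a) (-b)
      simp only [neg_neg'] at e2
      rw [Equiv.Perm.mul_apply, e1, e2, ← Equiv.Perm.mul_apply, hcomm]⟩

/-- The Coxeter length of a signed permutation: the least length of a word in the simple
generators representing it. -/
noncomputable def length {n : ℕ} (w : SignedPerm n) : ℕ :=
  sInf {k : ℕ | ∃ l : List (Fin n), l.length = k ∧ (l.map simpleRefl).prod = w}

/-- The index `i` is a right descent of `w`. -/
def IsRightDescent {n : ℕ} (w : SignedPerm n) (i : Fin n) : Prop :=
  length (w * simpleRefl i) < length w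

/-- The covering relation of the right weak Bruhat order. -/
def WeakCovers {n : ℕ} (w v : SignedPerm n) : Prop :=
  ∃ i : Fin n, v = w * simpleRefl i ∧ ¬ IsRightDescent w i

/-- The right weak Bruhat order. -/
def WeakLE {n : ℕ} : SignedPerm n → SignedPerm n → Prop :=
  Relation.ReflTransGen WeakCovers

/-- The interval `[u, w]_R` in the right weak Bruhat order. -/
def weakInterval {n : ℕ} (u w : SignedPerm n) : Set (SignedPerm n) :=
  {v | WeakLE u v ∧ WeakLE v w}

/-! ### Posets of type B -/

/-- A `B_n` poset: a partial order `≼` on `[-n, n]` with `i ≼ j` iff `-j ≼ -i`. -/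
@[ext]
structure BnPoset (n : ℕ) where
  le : SInt n → SInt n → Prop
  le_refl : ∀ x, le x x
  le_trans : ∀ x y z, le x y → le y z → le x z
  le_antisymm : ∀ x y, le x y → le y x → x = y
  le_neg : ∀ x y, le x y ↔ le (-y) (-x)

namespace BnPoset

variable {n : ℕ}

/-- The strict order of a `B_n` poset. -/
def lt (P : BnPoset n) (x y : SInt n) : Prop := P.le x y ∧ x ≠ y

/-- Comparability in a `B_n` poset. -/
def Comparable (P : BnPoset n) (x y : SInt n) : Prop := P.le x y ∨ P.le y x

/-- `P` is distinguished if whenever `x` and `-x` are comparable, both are comparable to `0`. -/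
def IsDistinguished (P : BnPoset n) : Prop :=
  ∀ x, P.Comparable x (-x) → P.Comparable x 0 ∧ P.Comparable (-x) 0

/-- Regular `B_n` posets; `x < y < z` refers to the usual order of the integers. -/
def IsRegular (P : BnPoset n) : Prop :=
  P.IsDistinguished ∧ ∀ x y z : SInt n, x < y → y < z →
    (P.lt x z → P.lt x y ∨ P.lt y z) ∧ (P.lt z x → P.lt z y ∨ P.lt y x)

/-- The type-B linear extensions of `P`: linear extensions of `P` that are `B_n` posets. -/
def linearExtensions (P : BnPoset n) : Set (BnPoset n) :=
  {E | (∀ x y, E.le x y ∨ E.le y x) ∧ ∀ x y, P.le x y → E.le x y}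

end BnPoset

/-- The linear `B_n` poset `σ(-n) ≺ σ(-n+1) ≺ ⋯ ≺ σ(n)`, that is, `x ≼ y` iff
`σ⁻¹ x ≤ σ⁻¹ y`. -/
def linearPoset {n : ℕ} (σ : SignedPerm n) : BnPoset n where
  le x y := σ.1⁻¹ x ≤ σ.1⁻¹ y
  le_refl _ := le_refl _
  le_trans _ _ _ := le_trans
  le_antisymm _ _ h1 h2 := σ.1⁻¹.injective (le_antisymm h1 h2)
  le_neg x y := by
    have h := (SignedPerm n).inv_mem σ.2
    rw [h x, h y, neg_le_neg_iff']

/-- The set of signed permutations `γ` whose linear `B_n` poset is a type-B linear extension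
of `P`. -/
def signedExtensions {n : ℕ} (P : BnPoset n) : Set (SignedPerm n) :=
  {γ | linearPoset γ ∈ P.linearExtensions}

/-- The intersection of the linear orders attached to the elements of a nonempty set of signed
permutations. -/
def posetOf {n : ℕ} (U : Set (SignedPerm n)) (hU : U.Nonempty) : BnPoset n where
  le x y := ∀ σ ∈ U, (linearPoset σ).le x y
  le_refl x σ _ := (linearPoset σ).le_refl x
  le_trans x y z h1 h2 σ hσ := (linearPoset σ).le_trans x y z (h1 σ hσ) (h2 σ hσ)
  le_antisymm x y h1 h2 := by
    obtain ⟨σ, hσ⟩ := hU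
    exact (linearPoset σ).le_antisymm x y (h1 σ hσ) (h2 σ hσ)
  le_neg x y := forall₂_congr fun σ _ => (linearPoset σ).le_neg x y

/-! ### Window notation -/

/-- The map `[-n, n] → [-n, n]` with `i ↦ w_i`, `-i ↦ -w_i` for `1 ≤ i ≤ n`, and `0 ↦ 0`.
The entry `w_i` is `w (i - 1)`, because `Fin n` starts at `0`. -/
def windowFun {n : ℕ} (w : Fin n → SInt n) (x : SInt n) : SInt n :=
  if h : 0 < (x : ℤ) then w ⟨(x : ℤ).toNat - 1, by have := x.2.2; omega⟩
  else if h' : (x : ℤ) < 0 then -w ⟨(-(x : ℤ)).toNat - 1, by have := x.2.1; omega⟩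
  else 0

theorem windowFun_neg {n : ℕ} (w : Fin n → SInt n) (x : SInt n) :
    windowFun w (-x) = -windowFun w x := by
  unfold windowFun
  simp only [coe_neg]
  rcases lt_trichotomy (x : ℤ) 0 with h | h | h
  · rw [dif_pos (by omega), dif_neg (by omega), dif_pos h, neg_neg']
  · rw [dif_neg (by omega), dif_neg (by omega), dif_neg (by omega), dif_neg (by omega)]
    exact Subtype.ext (by simp [coe_neg, coe_zero])
  · rw [dif_neg (by omega), dif_pos (by omega), dif_pos h]
    simp only [neg_neg]

/-- The entries of `w` have distinct nonzero absolute values. -/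
def IsWindow {n : ℕ} (w : Fin n → SInt n) : Prop :=
  (∀ i, w i ≠ 0) ∧ ∀ i j, w i = w j ∨ w i = -w j → i = j

theorem windowFun_injective {n : ℕ} {w : Fin n → SInt n} (hw : IsWindow w) :
    Function.Injective (windowFun w) := by
  have hn : ∀ i, -w i ≠ 0 := fun i h => hw.1 i (by
    rw [← neg_neg' (w i), h]; exact Subtype.ext (by simp [coe_neg, coe_zero]))
  have key : ∀ i j, w i = w j ∨ w i = -w j → i.val = j.val :=
    fun i j h => congrArg Fin.val (hw.2 i j h)
  have anti : ∀ i, w i ≠ -w i := fun i h => hw.1 i (by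
    have h1 := congrArg Subtype.val h
    rw [coe_neg] at h1
    exact Subtype.ext (by rw [coe_zero]; omega))
  intro x y hxy
  unfold windowFun at hxy
  apply Subtype.ext
  rcases lt_trichotomy (x : ℤ) 0 with hx | hx | hx <;>
    rcases lt_trichotomy (y : ℤ) 0 with hy | hy | hy
  · rw [dif_neg (by omega), dif_pos hx, dif_neg (by omega), dif_pos hy, neg_inj'] at hxy
    have := key _ _ (Or.inl hxy)
    simp only at this
    omega
  · rw [dif_neg (by omega), dif_pos hx, dif_neg (by omega), dif_neg (by omega)] at hxy
    exact absurd hxy (hn _)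
  · rw [dif_neg (by omega), dif_pos hx, dif_pos hy] at hxy
    have h1 := hw.2 _ _ (Or.inr hxy.symm)
    rw [h1] at hxy
    exact absurd hxy.symm (anti _)
  · rw [dif_neg (by omega), dif_neg (by omega), dif_neg (by omega), dif_pos hy] at hxy
    exact absurd hxy.symm (hn _)
  · omega
  · rw [dif_neg (by omega), dif_neg (by omega), dif_pos hy] at hxy
    exact absurd hxy.symm (hw.1 _)
  · rw [dif_pos hx, dif_neg (by omega), dif_pos hy] at hxy
    have h1 := hw.2 _ _ (Or.inr hxy)
    rw [h1] at hxy
    exact absurd hxy (anti _)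
  · rw [dif_pos hx, dif_neg (by omega), dif_neg (by omega)] at hxy
    exact absurd hxy (hw.1 _)
  · rw [dif_pos hx, dif_pos hy] at hxy
    have := key _ _ (Or.inl hxy)
    simp only at this
    omega

/-- The signed permutation `[w_1, …, w_n]` in window notation. -/
noncomputable def ofWindow {n : ℕ} (w : Fin n → SInt n) (hw : IsWindow w) : SignedPerm n :=
  ⟨Equiv.ofBijective (windowFun w) (Finite.injective_iff_bijective.mp (windowFun_injective hw)),
    fun x => windowFun_neg w x⟩

/-! ### The algorithm -/

namespace BnPoset

variable {n : ℕ}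

open Classical in
/-- The minimal elements of the subposet of `P` on `Q`. -/
noncomputable def minimals (P : BnPoset n) (Q : Finset (SInt n)) : Finset (SInt n) :=
  Q.filter fun x => ∀ y ∈ Q, ¬ P.lt y x

theorem mem_minimals {P : BnPoset n} {Q : Finset (SInt n)} {x : SInt n} :
    x ∈ P.minimals Q ↔ x ∈ Q ∧ ∀ y ∈ Q, ¬ P.lt y x := by
  classical
  simp [minimals]

theorem minimals_nonempty (P : BnPoset n) {Q : Finset (SInt n)} (hQ : Q.Nonempty) :
    (P.minimals Q).Nonempty := by
  have : Std.Irrefl P.lt := ⟨fun x h => h.2 rfl⟩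
  have : IsTrans (SInt n) P.lt := ⟨fun x y z h1 h2 => ⟨P.le_trans _ _ _ h1.1 h2.1, fun h =>
    h1.2 (P.le_antisymm _ _ h1.1 (h ▸ h2.1))⟩⟩
  obtain ⟨m, hm, hmin⟩ :=
    (Finite.wellFounded_of_trans_of_irrefl P.lt).has_min (Q : Set (SInt n)) hQ
  exact ⟨m, mem_minimals.mpr ⟨hm, fun y hy => hmin y hy⟩⟩

/-- The smallest integer among the minimal elements of `Q` (with value `0` if `Q` is empty,
which does not occur in the algorithm). -/
noncomputable def chooseSmallest (P : BnPoset n) (Q : Finset (SInt n)) : SInt n :=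
  if hQ : Q.Nonempty then (P.minimals Q).min' (P.minimals_nonempty hQ) else 0

/-- The largest integer among the minimal elements of `Q` (with value `0` if `Q` is empty,
which does not occur in the algorithm). -/
noncomputable def chooseLargest (P : BnPoset n) (Q : Finset (SInt n)) : SInt n :=
  if hQ : Q.Nonempty then (P.minimals Q).max' (P.minimals_nonempty hQ) else 0

open Classical in
/-- The initial set of the algorithm for the lower end of the interval. -/
noncomputable def initQ₁ (P : BnPoset n) : Finset (SInt n) :=
  (Finset.univ.filter fun x => P.lt 0 x) ∪
    Finset.univ.filter fun x => 0 < x ∧ ¬ P.Comparable x 0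

open Classical in
/-- The initial set of the algorithm for the upper end of the interval. -/
noncomputable def initQ₂ (P : BnPoset n) : Finset (SInt n) :=
  (Finset.univ.filter fun x => P.lt 0 x) ∪
    Finset.univ.filter fun x => x < 0 ∧ ¬ P.Comparable x 0

end BnPoset

/-- The sets `Q^(0) = Q`, `Q^(k+1) = Q^(k) \ {c(Q^(k))}` for a choice rule `c`. -/
def remaining {n : ℕ} (c : Finset (SInt n) → SInt n) (Q : Finset (SInt n)) :
    ℕ → Finset (SInt n)
  | 0 => Q
  | k + 1 => (remaining c Q k).erase (c (remaining c Q k))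

/-- The sequence of elements removed by the algorithm: its entry at `k` (starting from `0`) is
`c(Q^(k))`. -/
def chosen {n : ℕ} (c : Finset (SInt n) → SInt n) (Q : Finset (SInt n)) (k : Fin n) : SInt n :=
  c (remaining c Q k.val)

/-- `Q` contains exactly one of `x` and `-x` for every nonzero `x`, and it does not contain
`0`. -/
def IsHalf {n : ℕ} (Q : Finset (SInt n)) : Prop :=
  (0 : SInt n) ∉ Q ∧ ∀ x : SInt n, x ≠ 0 → (x ∈ Q ↔ -x ∉ Q)

theorem IsHalf.card {n : ℕ} {Q : Finset (SInt n)} (hQ : IsHalf Q) : Q.card = n := by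
  classical
  have hinj : Function.Injective (fun x : SInt n => -x) := fun x y h => neg_inj'.mp h
  have h1 : (Finset.univ : Finset (SInt n)) = insert 0 (Q ∪ Q.image fun x => -x) := by
    ext x
    simp only [Finset.mem_univ, Finset.mem_insert, Finset.mem_union, Finset.mem_image, true_iff]
    by_cases hx : x = 0
    · exact Or.inl hx
    · by_cases hxQ : x ∈ Q
      · exact Or.inr (Or.inl hxQ)
      · refine Or.inr (Or.inr ⟨-x, ?_, neg_neg' x⟩)
        by_contra h
        exact hxQ ((hQ.2 x hx).mpr h)
  have h2 : Disjoint Q (Q.image fun x => -x) := by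
    rw [Finset.disjoint_left]
    intro x hx hx'
    obtain ⟨y, hy, rfl⟩ := Finset.mem_image.mp hx'
    have hy0 : y ≠ 0 := fun h => hQ.1 (h ▸ hy)
    exact (hQ.2 y hy0).mp hy hx
  have h3 : (0 : SInt n) ∉ Q ∪ Q.image fun x => -x := by
    intro h
    rcases Finset.mem_union.mp h with h | h
    · exact hQ.1 h
    · obtain ⟨y, hy, hy0⟩ := Finset.mem_image.mp h
      have : y = 0 := by
        rw [← neg_neg' y, hy0]; exact Subtype.ext (by simp [coe_neg, coe_zero])
      exact hQ.1 (this ▸ hy)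
  have h4 := congrArg Finset.card h1
  rw [Finset.card_insert_of_notMem h3, Finset.card_union_of_disjoint h2,
    Finset.card_image_of_injective _ hinj, Finset.card_univ] at h4
  have h5 : Fintype.card (SInt n) = 2 * n + 1 := by
    rw [Fintype.card_of_finset' (Finset.Icc (-(n : ℤ)) n) (by simp), Int.card_Icc]
    omega
  omega

theorem remaining_anti {n : ℕ} (c : Finset (SInt n) → SInt n) (Q : Finset (SInt n))
    {j k : ℕ} (h : j ≤ k) : remaining c Q k ⊆ remaining c Q j := by
  induction h with
  | refl => exact subset_rfl
  | step _ ih => exact (Finset.erase_subset _ _).trans ih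

theorem isWindow_chosen {n : ℕ} (c : Finset (SInt n) → SInt n)
    (hc : ∀ Q : Finset (SInt n), Q.Nonempty → c Q ∈ Q) {Q : Finset (SInt n)} (hQ : IsHalf Q) :
    IsWindow (chosen c Q) := by
  have hcard : ∀ k, n ≤ (remaining c Q k).card + k := by
    intro k
    induction k with
    | zero => exact hQ.card.ge
    | succ k ih =>
      have := Finset.pred_card_le_card_erase (s := remaining c Q k) (a := c (remaining c Q k))
      change n ≤ ((remaining c Q k).erase (c (remaining c Q k))).card + (k + 1)
      omega
  have hmem : ∀ k : Fin n, chosen c Q k ∈ remaining c Q k.val := fun k =>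
    hc _ (Finset.card_pos.mp (by have := hcard k.val; have := k.2; omega))
  have hmemQ : ∀ k : Fin n, chosen c Q k ∈ Q := fun k =>
    remaining_anti c Q (Nat.zero_le _) (hmem k)
  have hne : ∀ i j : Fin n, i < j → chosen c Q i ≠ chosen c Q j := by
    intro i j hij h
    have h1 : chosen c Q j ∈ remaining c Q (i.val + 1) := remaining_anti c Q hij (hmem j)
    exact Finset.ne_of_mem_erase h1 h.symm
  have h0 : ∀ i, chosen c Q i ≠ 0 := fun i h => hQ.1 (h ▸ hmemQ i)
  refine ⟨h0, fun i j h => ?_⟩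
  rcases h with h | h
  · rcases lt_trichotomy i j with hij | hij | hij
    · exact absurd h (hne i j hij)
    · exact hij
    · exact absurd h.symm (hne j i hij)
  · exact absurd (h ▸ hmemQ i) ((hQ.2 _ (h0 j)).mp (hmemQ j))

namespace BnPoset

variable {n : ℕ}

theorem chooseSmallest_mem (P : BnPoset n) (Q : Finset (SInt n)) (hQ : Q.Nonempty) :
    P.chooseSmallest Q ∈ Q := by
  rw [chooseSmallest, dif_pos hQ]
  exact (mem_minimals.mp (Finset.min'_mem _ _)).1

theorem chooseLargest_mem (P : BnPoset n) (Q : Finset (SInt n)) (hQ : Q.Nonempty) :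
    P.chooseLargest Q ∈ Q := by
  rw [chooseLargest, dif_pos hQ]
  exact (mem_minimals.mp (Finset.max'_mem _ _)).1

theorem neg_zero' : -(0 : SInt n) = 0 := Subtype.ext (by simp [coe_neg, coe_zero])

theorem le_zero_iff (P : BnPoset n) (x : SInt n) : P.le x 0 ↔ P.le 0 (-x) := by
  rw [P.le_neg, neg_zero']

theorem zero_le_iff (P : BnPoset n) (x : SInt n) : P.le 0 x ↔ P.le (-x) 0 := by
  rw [P.le_neg, neg_zero']

theorem isHalf_initQ₁ (P : BnPoset n) : IsHalf P.initQ₁ := by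
  have hm : ∀ x, x ∈ P.initQ₁ ↔ P.lt 0 x ∨ 0 < x ∧ ¬ P.Comparable x 0 := by
    intro x; simp [initQ₁]
  refine ⟨fun h => ?_, fun x hx => ?_⟩
  · rcases (hm 0).mp h with h | h
    · exact h.2 rfl
    · exact lt_irrefl _ h.1
  · have hx' : (x : ℤ) ≠ 0 := fun h => hx (Subtype.ext h)
    have hn : (0 : SInt n) ≠ -x := fun h => hx (by rw [← neg_neg' x, ← h, neg_zero'])
    have ha := P.le_antisymm x 0
    have hz := P.le_zero_iff x
    have hz' := P.zero_le_iff x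
    have e1 : (0 : SInt n) < x ↔ (0 : ℤ) < (x : ℤ) := Iff.rfl
    have e2 : (0 : SInt n) < -x ↔ (0 : ℤ) < -(x : ℤ) := Iff.rfl
    have hs : (0 : SInt n) < -x ↔ ¬ (0 : SInt n) < x := by rw [e1, e2]; omega
    rw [hm, hm]
    unfold lt Comparable
    have := hx.symm
    tauto

theorem isHalf_initQ₂ (P : BnPoset n) : IsHalf P.initQ₂ := by
  have hm : ∀ x, x ∈ P.initQ₂ ↔ P.lt 0 x ∨ x < 0 ∧ ¬ P.Comparable x 0 := by
    intro x; simp [initQ₂]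
  refine ⟨fun h => ?_, fun x hx => ?_⟩
  · rcases (hm 0).mp h with h | h
    · exact h.2 rfl
    · exact lt_irrefl _ h.1
  · have hx' : (x : ℤ) ≠ 0 := fun h => hx (Subtype.ext h)
    have hn : (0 : SInt n) ≠ -x := fun h => hx (by rw [← neg_neg' x, ← h, neg_zero'])
    have ha := P.le_antisymm x 0
    have hz := P.le_zero_iff x
    have hz' := P.zero_le_iff x
    have e1 : x < (0 : SInt n) ↔ (x : ℤ) < (0 : ℤ) := Iff.rfl
    have e2 : -x < (0 : SInt n) ↔ -(x : ℤ) < (0 : ℤ) := Iff.rfl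
    have hs : -x < (0 : SInt n) ↔ ¬ x < (0 : SInt n) := by rw [e1, e2]; omega
    rw [hm, hm]
    unfold lt Comparable
    have := hx.symm
    tauto

/-- The signed permutation `[a_1, …, a_n]` where `a_k` is the smallest integer among the minimal
elements of what remains of `initQ₁` after removing `a_1, …, a_{k-1}`. -/
noncomputable def sigma (P : BnPoset n) : SignedPerm n :=
  ofWindow (chosen P.chooseSmallest P.initQ₁)
    (isWindow_chosen _ P.chooseSmallest_mem P.isHalf_initQ₁)

/-- The signed permutation `[b_1, …, b_n]` where `b_k` is the largest integer among the minimal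
elements of what remains of `initQ₂` after removing `b_1, …, b_{k-1}`. -/
noncomputable def rho (P : BnPoset n) : SignedPerm n :=
  ofWindow (chosen P.chooseLargest P.initQ₂)
    (isWindow_chosen _ P.chooseLargest_mem P.isHalf_initQ₂)

end BnPoset

end TypeB

/-!
The argument rests on describing everything by inversions: a pair of integers `x < y` is inverted
by `w` if `y` occurs before `x` in `w(-n), …, w(n)`, that is, if `w⁻¹ y < w⁻¹ x`.

Right multiplication by a simple generator at an ascent of `w` adds exactly one inversion up to the
symmetry `(x, y) ↦ (-y, -x)` (`card_inversions_mul_of_ascent`). Hence the Coxeter length is the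
number of inversions modulo this symmetry (`length_eq_card_inversions`), the non-descents are the
positions of ascents, and the right weak order is containment of inversion sets (`weakLE_iff`): if
`u ≠ w` and every inversion of `u` is one of `w`, then some two adjacent entries of `u` are
reversed in `w`, and one can go up from `u` by exchanging them. So `γ` lies in `[σ, ρ]` if and only
if it inverts all pairs inverted by `σ` and preserves the order of all pairs preserved by `ρ`
(`mem_weakInterval_iff`). In the same terms, `γ` is a linear extension of `P` if and only if it
inverts the pairs `x < y` with `y ≺ x` in `P` and preserves those with `x ≺ y`
(`mem_signedExtensions_iff`).

It remains to compare the two descriptions. For a regular poset `P`, the greedy algorithm that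
prefers small integers inverts exactly the pairs that `P` forces to be inverted, and the one that
prefers large integers preserves exactly the pairs that `P` forces to be preserved. Both are
instances of `greedy_lt_iff`, for the orders `<` and `>`; regularity enters because an element `x`
that is passed over in favour of `y` lies above some minimal `m`, and `y` either is `m` or lies
between `x` and `m` as integers. Conversely, for `σ ≤ ρ` the poset of `{σ, ρ}` inverts the pairs inverted by `σ` and
preserves those preserved by `ρ` (`posetOf_pair_lt_iff`), and regularity is then totality of the
two linear orders.
-/

namespace TypeB

variable {n : ℕ}

/-! ### Inversions and simple reflections -/

/-- The action of the `i`-th simple generator on integers. -/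
def reflInt (i : ℕ) (p : ℤ) : ℤ :=
  if i = 0 then (if p = 1 then -1 else if p = -1 then 1 else p)
  else if p = i then i + 1 else if p = i + 1 then i
  else if p = -i then -(i + 1) else if p = -(i + 1) then -i else p

theorem coe_simpleRefl (i : Fin n) (x : SInt n) :
    (((simpleRefl i).1 x : SInt n) : ℤ) = reflInt i.val x := by
  unfold simpleRefl reflInt
  split_ifs <;>
    simp only [Equiv.Perm.mul_apply, Equiv.swap_apply_def, Subtype.ext_iff, coe_neg, coe_nat] <;>
    split_ifs <;> (try simp only [coe_neg, coe_nat] at *) <;> push_cast at * <;> omega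

/-- The pairs of positions `p < q` whose relative order is reversed by the `i`-th simple
generator. -/
def FlipInt (i : ℕ) (p q : ℤ) : Prop :=
  (p = i ∧ q = i + 1) ∨ (p = -(i + 1) ∧ q = -i) ∨ (i = 0 ∧ p = -1 ∧ q = 1)

theorem reflInt_reflInt (i : ℕ) (p : ℤ) : reflInt i (reflInt i p) = p := by
  grind [reflInt]

theorem reflInt_lt_iff (i : ℕ) (p q : ℤ) :
    reflInt i q < reflInt i p ↔ (q < p ∧ ¬ FlipInt i q p) ∨ FlipInt i p q := by
  unfold reflInt FlipInt
  split_ifs <;> omega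

/-- The entry of `w` at position `i`, for `0 ≤ i < n`. -/
def entry (w : SignedPerm n) (i : Fin n) : SInt n := w.1 (nat i.val i.2.le)

/-- The entry of `w` at position `i + 1`, for `0 ≤ i < n`. -/
def entrySucc (w : SignedPerm n) (i : Fin n) : SInt n := w.1 (nat (i.val + 1) i.2)

/-- The pairs of values `(x, y)` which occur in this order in `w` and whose relative order is
reversed in `w * simpleRefl i`. -/
def Flip (w : SignedPerm n) (i : Fin n) (x y : SInt n) : Prop :=
  (x = entry w i ∧ y = entrySucc w i) ∨ (x = -entrySucc w i ∧ y = -entry w i) ∨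
    (i.val = 0 ∧ x = -entrySucc w i ∧ y = entrySucc w i)

theorem apply_neg (w : SignedPerm n) (x : SInt n) : w.1 (-x) = -w.1 x :=
  w.2 x

theorem inv_apply_neg (w : SignedPerm n) (x : SInt n) : w.1⁻¹ (-x) = -w.1⁻¹ x :=
  (SignedPerm n).inv_mem w.2 x

theorem apply_zero (w : SignedPerm n) : w.1 0 = 0 := by
  have h := w.2 0
  rw [BnPoset.neg_zero'] at h
  have h1 := congrArg Subtype.val h
  rw [coe_neg] at h1
  exact Subtype.ext (by rw [coe_zero]; omega)

theorem inv_apply_zero (w : SignedPerm n) : w.1⁻¹ 0 = 0 := apply_zero w⁻¹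

theorem nat_zero (h : 0 ≤ n) : (nat 0 h : SInt n) = 0 := rfl

theorem flipInt_iff_flip (w : SignedPerm n) (i : Fin n) (x y : SInt n) :
    FlipInt i.val (w.1⁻¹ x : SInt n) (w.1⁻¹ y : SInt n) ↔ Flip w i x y := by
  have key : ∀ z p : SInt n, z = w.1 p ↔ ((w.1⁻¹ z : SInt n) : ℤ) = p := fun z p => by
    rw [← Subtype.ext_iff, Equiv.Perm.inv_eq_iff_eq]
  unfold FlipInt Flip entry entrySucc
  simp only [← apply_neg, key]
  simp only [coe_neg, coe_nat]
  push_cast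
  constructor <;> intro h <;> omega

theorem lt_mul_simpleRefl_iff (w : SignedPerm n) (i : Fin n) (x y : SInt n) :
    (w * simpleRefl i).1⁻¹ y < (w * simpleRefl i).1⁻¹ x ↔
      (w.1⁻¹ y < w.1⁻¹ x ∧ ¬ Flip w i y x) ∨ Flip w i x y := by
  have hs : ∀ z : SInt n, (simpleRefl i).1⁻¹ z = (simpleRefl i).1 z := fun z => by
    rw [Equiv.Perm.inv_eq_iff_eq]
    refine Subtype.ext ?_
    rw [coe_simpleRefl, coe_simpleRefl, reflInt_reflInt]
  have hm : ∀ z : SInt n, (w * simpleRefl i).1⁻¹ z = (simpleRefl i).1 (w.1⁻¹ z) := fun z => by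
    rw [← hs, Subgroup.coe_mul, mul_inv_rev, Equiv.Perm.mul_apply]
  rw [hm, hm, ← Subtype.coe_lt_coe, coe_simpleRefl, coe_simpleRefl, reflInt_lt_iff,
    flipInt_iff_flip, flipInt_iff_flip, Subtype.coe_lt_coe]

theorem simpleRefl_mul_self (i : Fin n) : simpleRefl i * simpleRefl i = 1 := by
  refine Subtype.ext (Equiv.ext fun z => Subtype.ext ?_)
  rw [Subgroup.coe_mul, Equiv.Perm.mul_apply, coe_simpleRefl, coe_simpleRefl, reflInt_reflInt]
  rfl

theorem entry_mul_simpleRefl (w : SignedPerm n) (i : Fin n) (hi : i.val ≠ 0) :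
    entry (w * simpleRefl i) i = entrySucc w i := by
  unfold entry entrySucc
  rw [Subgroup.coe_mul, Equiv.Perm.mul_apply]
  refine congrArg _ (Subtype.ext ?_)
  rw [coe_simpleRefl, coe_nat, coe_nat]
  unfold reflInt
  split_ifs <;> push_cast at * <;> omega

theorem entrySucc_mul_simpleRefl (w : SignedPerm n) (i : Fin n) (hi : i.val ≠ 0) :
    entrySucc (w * simpleRefl i) i = entry w i := by
  rw [← entry_mul_simpleRefl _ i hi, mul_assoc, simpleRefl_mul_self, mul_one]

theorem entry_of_val_eq_zero (w : SignedPerm n) (i : Fin n) (hi : i.val = 0) :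
    entry w i = 0 := by
  have : (nat i.val i.2.le : SInt n) = 0 := Subtype.ext (by rw [coe_nat, hi]; rfl)
  rw [entry, this, apply_zero]

theorem entrySucc_mul_simpleRefl_of_val_eq_zero (w : SignedPerm n) (i : Fin n)
    (hi : i.val = 0) : entrySucc (w * simpleRefl i) i = -entrySucc w i := by
  unfold entrySucc
  rw [Subgroup.coe_mul, Equiv.Perm.mul_apply, ← apply_neg]
  refine congrArg _ (Subtype.ext ?_)
  rw [coe_simpleRefl, coe_neg, coe_nat]
  unfold reflInt
  split_ifs <;> push_cast at * <;> omega

theorem entry_ne_entrySucc (w : SignedPerm n) (i : Fin n) : entry w i ≠ entrySucc w i := by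
  intro h
  have := congrArg Subtype.val (w.1.injective h)
  rw [coe_nat, coe_nat] at this
  omega

theorem entry_ne_neg_entrySucc (w : SignedPerm n) (i : Fin n) :
    entry w i ≠ -entrySucc w i := by
  intro h
  rw [entrySucc, ← apply_neg] at h
  have := congrArg Subtype.val (w.1.injective h)
  rw [coe_neg, coe_nat, coe_nat] at this
  omega

theorem entry_eq_zero_iff (w : SignedPerm n) (i : Fin n) : entry w i = 0 ↔ i.val = 0 := by
  refine ⟨fun h => ?_, entry_of_val_eq_zero w i⟩
  rw [← apply_zero w] at h
  have := congrArg Subtype.val (w.1.injective h)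
  rw [coe_nat, coe_zero] at this
  omega

theorem entrySucc_ne_zero (w : SignedPerm n) (i : Fin n) : entrySucc w i ≠ 0 := by
  intro h
  rw [← apply_zero w] at h
  have := congrArg Subtype.val (w.1.injective h)
  rw [coe_nat, coe_zero] at this
  omega

theorem ascent_mul_simpleRefl {w : SignedPerm n} {i : Fin n} (h : entrySucc w i < entry w i) :
    entry (w * simpleRefl i) i < entrySucc (w * simpleRefl i) i := by
  by_cases hi : i.val = 0
  · rw [entry_of_val_eq_zero _ i hi] at h ⊢
    rw [entrySucc_mul_simpleRefl_of_val_eq_zero w i hi]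
    rw [← Subtype.coe_lt_coe] at h ⊢
    rw [coe_neg]
    rw [coe_zero] at h ⊢
    omega
  · rwa [entry_mul_simpleRefl w i hi, entrySucc_mul_simpleRefl w i hi]

/-- At an ascent, the generator turns non-inversions of `w` into inversions, never the
reverse. -/
theorem Flip.lt {w : SignedPerm n} {i : Fin n} (ha : entry w i < entrySucc w i)
    {x y : SInt n} (h : Flip w i x y) : x < y := by
  rcases h with ⟨rfl, rfl⟩ | ⟨rfl, rfl⟩ | ⟨hi, rfl, rfl⟩
  · exact ha
  · rw [← Subtype.coe_lt_coe] at ha ⊢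
    rw [coe_neg, coe_neg]
    omega
  · rw [entry_of_val_eq_zero w i hi] at ha
    rw [← Subtype.coe_lt_coe] at ha ⊢
    rw [coe_neg]
    rw [coe_zero] at ha
    omega

theorem Flip.inv_lt {w : SignedPerm n} {i : Fin n} {x y : SInt n} (h : Flip w i x y) :
    w.1⁻¹ x < w.1⁻¹ y := by
  rw [← flipInt_iff_flip] at h
  rw [← Subtype.coe_lt_coe]
  unfold FlipInt at h
  omega

/-- A signed permutation that inverts the two adjacent entries of `w` inverts every pair of values
flipped by the generator. -/
theorem Flip.lt_of_lt {w v : SignedPerm n} {i : Fin n} {x y : SInt n} (h : Flip w i x y)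
    (hv : v.1⁻¹ (entrySucc w i) < v.1⁻¹ (entry w i)) : v.1⁻¹ y < v.1⁻¹ x := by
  rcases h with ⟨rfl, rfl⟩ | ⟨rfl, rfl⟩ | ⟨hi, rfl, rfl⟩
  · exact hv
  · rw [inv_apply_neg, inv_apply_neg]
    rw [← Subtype.coe_lt_coe] at hv ⊢
    rw [coe_neg, coe_neg]
    omega
  · rw [entry_of_val_eq_zero w i hi, inv_apply_zero] at hv
    rw [inv_apply_neg]
    rw [← Subtype.coe_lt_coe] at hv ⊢
    rw [coe_neg]
    rw [coe_zero] at hv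
    omega

theorem lt_mul_simpleRefl_iff_of_ascent {w : SignedPerm n} {i : Fin n}
    (ha : entry w i < entrySucc w i) {x y : SInt n} (hxy : x < y) :
    (w * simpleRefl i).1⁻¹ y < (w * simpleRefl i).1⁻¹ x ↔
      w.1⁻¹ y < w.1⁻¹ x ∨ Flip w i x y := by
  rw [lt_mul_simpleRefl_iff]
  have : ¬ Flip w i y x := fun h => lt_asymm hxy (h.lt ha)
  tauto

/-- The inversions of a signed permutation, as pairs of values, one from each orbit
`{(x, y), (-y, -x)}`. The pairs `(0, y)` are left out, because `(0, y)` is an inversion if and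
only if `(-y, y)` is one; so each reflection of the hyperoctahedral group is counted once. -/
noncomputable def inversions (w : SignedPerm n) : Finset (SInt n × SInt n) :=
  Finset.univ.filter fun p =>
    (p.1 < p.2 ∧ 0 ≤ (p.1 : ℤ) + p.2 ∧ p.1 ≠ 0) ∧ w.1⁻¹ p.2 < w.1⁻¹ p.1

theorem mem_inversions {w : SignedPerm n} {x y : SInt n} :
    (x, y) ∈ inversions w ↔
      (x < y ∧ 0 ≤ (x : ℤ) + y ∧ x ≠ 0) ∧ w.1⁻¹ y < w.1⁻¹ x := by
  simp [inversions]

theorem exists_flip_iff_eq {w : SignedPerm n} {i : Fin n} (ha : entry w i < entrySucc w i) :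
    ∃ p : SInt n × SInt n, ∀ x y : SInt n,
      (Flip w i x y ∧ 0 ≤ (x : ℤ) + y ∧ x ≠ 0) ↔ (x, y) = p := by
  have h1 := entry_ne_neg_entrySucc w i
  have h2 := entry_eq_zero_iff w i
  have h3 := entrySucc_ne_zero w i
  unfold Flip
  generalize entry w i = a at *
  generalize entrySucc w i = b at *
  simp only [ne_eq, Prod.ext_iff, Subtype.ext_iff, coe_neg, coe_zero] at *
  rw [← Subtype.coe_lt_coe] at ha
  by_cases hi : i.val = 0
  · exact ⟨(-b, b), fun x y => by dsimp only; rw [coe_neg]; omega⟩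
  · by_cases hab : 0 < (a : ℤ) + b
    · exact ⟨(a, b), fun x y => by dsimp only; omega⟩
    · exact ⟨(-b, -a), fun x y => by dsimp only; rw [coe_neg, coe_neg]; omega⟩

theorem card_inversions_mul_of_ascent {w : SignedPerm n} {i : Fin n}
    (ha : entry w i < entrySucc w i) :
    (inversions (w * simpleRefl i)).card = (inversions w).card + 1 := by
  obtain ⟨p, hp⟩ := exists_flip_iff_eq ha
  have hnot : p ∉ inversions w := by
    rw [← Prod.mk.eta (p := p), mem_inversions]
    exact fun h => lt_asymm h.2 ((hp p.1 p.2).mpr rfl).1.inv_lt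
  rw [← Finset.card_insert_of_notMem hnot]
  congr 1
  ext ⟨x, y⟩
  rw [Finset.mem_insert, ← hp, mem_inversions, mem_inversions]
  by_cases hxy : x < y
  · rw [lt_mul_simpleRefl_iff_of_ascent ha hxy]
    tauto
  · have : ¬ Flip w i x y := fun h => hxy (h.lt ha)
    tauto

theorem card_inversions_mul_of_descent {w : SignedPerm n} {i : Fin n}
    (hd : entrySucc w i < entry w i) :
    (inversions w).card = (inversions (w * simpleRefl i)).card + 1 := by
  rw [← card_inversions_mul_of_ascent (ascent_mul_simpleRefl hd), mul_assoc,
    simpleRefl_mul_self, mul_one]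

/-! ### Length and the weak order -/

/-- Two signed permutations agree if every two adjacent entries of one occur in the same order in
the other. -/
theorem eq_of_forall_lt {u v : SignedPerm n}
    (h : ∀ i : Fin n, v.1⁻¹ (entry u i) < v.1⁻¹ (entrySucc u i)) : u = v := by
  let g : ℕ → ℤ := fun k => if hk : k ≤ n then (v.1⁻¹ (u.1 (nat k hk)) : SInt n) else 0
  have hg : ∀ k (hk : k ≤ n), g k = (v.1⁻¹ (u.1 (nat k hk)) : SInt n) := fun k hk => dif_pos hk
  have hstep : ∀ k, k < n → g k + 1 ≤ g (k + 1) := fun k hk => by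
    rw [hg k hk.le, hg (k + 1) hk]
    exact h ⟨k, hk⟩
  have hlow : ∀ k, k ≤ n → (k : ℤ) ≤ g k := by
    intro k
    induction k with
    | zero =>
      intro hk
      rw [hg 0 hk, nat_zero, apply_zero, inv_apply_zero]
      rfl
    | succ k ih =>
      intro hk
      have := ih (by omega)
      have := hstep k hk
      push_cast
      omega
  have hup : ∀ j, j ≤ n → g (n - j) ≤ (n : ℤ) - j := by
    intro j
    induction j with
    | zero =>
      intro _
      rw [Nat.sub_zero, hg n le_rfl]
      simpa using (v.1⁻¹ (u.1 (nat n le_rfl))).2.2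
    | succ j ih =>
      intro hj
      have h1 := ih (by omega)
      have h2 := hstep (n - (j + 1)) (by omega)
      rw [show n - (j + 1) + 1 = n - j by omega] at h2
      push_cast
      omega
  have hnat : ∀ k (hk : k ≤ n), u.1 (nat k hk) = v.1 (nat k hk) := fun k hk => by
    rw [← Equiv.Perm.inv_eq_iff_eq]
    refine Subtype.ext ?_
    rw [← hg k hk, coe_nat]
    have h1 := hup (n - k) (by omega)
    rw [show n - (n - k) = k by omega] at h1
    have h2 := hlow k hk
    omega
  refine Subtype.ext (Equiv.ext fun x => ?_)
  rcases le_total 0 (x : ℤ) with hx | hx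
  · have hx2 := x.2.2
    rw [show x = nat (x : ℤ).toNat (by omega) from Subtype.ext (by rw [coe_nat]; omega)]
    exact hnat _ _
  · have hx2 := x.2.1
    rw [show x = -nat (-(x : ℤ)).toNat (by omega) from
      Subtype.ext (by rw [coe_neg, coe_nat]; omega), apply_neg, apply_neg, hnat]

theorem inversions_one : inversions (1 : SignedPerm n) = ∅ := by
  refine Finset.eq_empty_of_forall_notMem fun ⟨x, y⟩ h => ?_
  rw [mem_inversions] at h
  exact lt_asymm h.1.1 h.2

theorem card_inversions_prod_le (l : List (Fin n)) :
    (inversions (l.map simpleRefl).prod).card ≤ l.length := by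
  induction l using List.reverseRecOn with
  | nil => simp [inversions_one]
  | append_singleton l i ih =>
    rw [List.map_append, List.prod_append, List.map_singleton, List.prod_singleton,
      List.length_append, List.length_singleton]
    rcases lt_or_gt_of_ne (entry_ne_entrySucc (l.map simpleRefl).prod i) with h | h
    · rw [card_inversions_mul_of_ascent h]
      omega
    · have := card_inversions_mul_of_descent h
      omega

theorem exists_word (w : SignedPerm n) :
    ∃ l : List (Fin n), l.length = (inversions w).card ∧ (l.map simpleRefl).prod = w := by
  induction hN : (inversions w).card generalizing w with
  | zero =>
    refine ⟨[], rfl, ?_⟩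
    refine (eq_of_forall_lt (v := 1) fun i => ?_).symm
    refine (lt_or_gt_of_ne (entry_ne_entrySucc w i)).resolve_right fun h => ?_
    have := card_inversions_mul_of_descent h
    omega
  | succ N ih =>
    obtain ⟨i, hi⟩ : ∃ i, entrySucc w i < entry w i := by
      by_contra! hcon
      have hw : w = 1 := eq_of_forall_lt (v := 1) fun i =>
        lt_of_le_of_ne (hcon i) (entry_ne_entrySucc w i)
      rw [hw, inversions_one] at hN
      simp at hN
    have hc := card_inversions_mul_of_descent hi
    obtain ⟨l, hl, hp⟩ := ih (w * simpleRefl i) (by omega)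
    refine ⟨l ++ [i], by simp [hl], ?_⟩
    rw [List.map_append, List.prod_append, List.map_singleton, List.prod_singleton, hp,
      mul_assoc, simpleRefl_mul_self, mul_one]

theorem length_eq_card_inversions (w : SignedPerm n) : length w = (inversions w).card := by
  refine le_antisymm (Nat.sInf_le (exists_word w)) (le_csInf ⟨_, exists_word w⟩ ?_)
  rintro k ⟨l, rfl, rfl⟩
  exact card_inversions_prod_le l

theorem not_isRightDescent_iff (w : SignedPerm n) (i : Fin n) :
    ¬ IsRightDescent w i ↔ entry w i < entrySucc w i := by
  unfold IsRightDescent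
  rw [length_eq_card_inversions, length_eq_card_inversions]
  rcases lt_or_gt_of_ne (entry_ne_entrySucc w i) with h | h
  · have := card_inversions_mul_of_ascent h
    exact ⟨fun _ => h, fun _ => by omega⟩
  · have := card_inversions_mul_of_descent h
    exact ⟨fun h' => absurd (by omega) h', fun h' => absurd h (lt_asymm h')⟩

/-- The right weak order is containment of inversion sets. -/
theorem weakLE_iff {u w : SignedPerm n} :
    WeakLE u w ↔ ∀ x y : SInt n, x < y → u.1⁻¹ y < u.1⁻¹ x → w.1⁻¹ y < w.1⁻¹ x := by
  constructor
  · intro h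
    induction h with
    | refl => exact fun _ _ _ h => h
    | tail _ hc ih =>
      obtain ⟨i, rfl, hi⟩ := hc
      rw [not_isRightDescent_iff] at hi
      exact fun x y hxy h => (lt_mul_simpleRefl_iff_of_ascent hi hxy).mpr (Or.inl (ih x y hxy h))
  · intro h
    have hcard : ∀ u : SignedPerm n,
        (∀ x y : SInt n, x < y → u.1⁻¹ y < u.1⁻¹ x → w.1⁻¹ y < w.1⁻¹ x) →
        (inversions u).card ≤ (inversions w).card := fun u hu =>
      Finset.card_le_card fun ⟨x, y⟩ hxy => by
        rw [mem_inversions] at hxy ⊢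
        exact ⟨hxy.1, hu x y hxy.1.1 hxy.2⟩
    induction hN : (inversions w).card - (inversions u).card using Nat.strong_induction_on
      generalizing u with
    | _ N ih =>
      by_cases huw : u = w
      · rw [huw]
        exact Relation.ReflTransGen.refl
      -- Some adjacent pair of `u` is reversed in `w`; as `w` keeps the inversions of `u`, the pair
      -- is an ascent of `u`.
      obtain ⟨i, hi⟩ : ∃ i, w.1⁻¹ (entrySucc u i) < w.1⁻¹ (entry u i) := by
        by_contra! hcon
        exact huw (eq_of_forall_lt fun i => lt_of_le_of_ne (hcon i) fun he =>
          entry_ne_entrySucc u i (w.1⁻¹.injective he))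
      have ha : entry u i < entrySucc u i := by
        refine (lt_or_gt_of_ne (entry_ne_entrySucc u i)).resolve_right fun hd => ?_
        refine lt_asymm hi (h _ _ hd ?_)
        exact Flip.inv_lt (Or.inl ⟨rfl, rfl⟩)
      have h' : ∀ x y : SInt n, x < y →
          (u * simpleRefl i).1⁻¹ y < (u * simpleRefl i).1⁻¹ x → w.1⁻¹ y < w.1⁻¹ x := by
        intro x y hxy hlt
        rcases (lt_mul_simpleRefl_iff_of_ascent ha hxy).mp hlt with h1 | h1
        · exact h x y hxy h1
        · exact h1.lt_of_lt hi
      have hc := card_inversions_mul_of_ascent ha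
      have hle := hcard _ h'
      exact Relation.ReflTransGen.head ⟨i, rfl, (not_isRightDescent_iff u i).mpr ha⟩
        (ih _ (by omega) h' rfl)

/-! ### The greedy algorithm -/

theorem windowFun_nat (w : Fin n → SInt n) (k : ℕ) (hk : k < n) :
    windowFun w (nat (k + 1) hk) = w ⟨k, hk⟩ := by
  unfold windowFun
  rw [dif_pos (by rw [coe_nat]; omega)]
  congr 1

theorem chosen_mem_remaining (c : Finset (SInt n) → SInt n)
    (hc : ∀ Q : Finset (SInt n), Q.Nonempty → c Q ∈ Q) {Q : Finset (SInt n)} (hQ : IsHalf Q)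
    (k : Fin n) : chosen c Q k ∈ remaining c Q k.val := by
  have hcard : ∀ k, n ≤ (remaining c Q k).card + k := by
    intro k
    induction k with
    | zero => exact hQ.card.ge
    | succ k ih =>
      have := Finset.pred_card_le_card_erase (s := remaining c Q k) (a := c (remaining c Q k))
      change n ≤ ((remaining c Q k).erase (c (remaining c Q k))).card + (k + 1)
      omega
  exact hc _ (Finset.card_pos.mp (by have := hcard k.val; have := k.2; omega))

theorem eq_zero_or_neg_mem {Q : Finset (SInt n)} (hQ : IsHalf Q) (x : SInt n) :
    x ∈ Q ∨ x = 0 ∨ -x ∈ Q := by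
  by_cases hx : x = 0
  · exact Or.inr (Or.inl hx)
  · have := hQ.2 x hx
    tauto

/-- Every element of the half `Q` is chosen at some step, and its position in the resulting
signed permutation is that step. -/
theorem exists_chosen_eq (c : Finset (SInt n) → SInt n)
    (hc : ∀ Q : Finset (SInt n), Q.Nonempty → c Q ∈ Q) {Q : Finset (SInt n)} (hQ : IsHalf Q)
    (hw : IsWindow (chosen c Q)) {x : SInt n} (hx : x ∈ Q) :
    ∃ k : Fin n, chosen c Q k = x ∧
      (((ofWindow (chosen c Q) hw).1⁻¹ x : SInt n) : ℤ) = k.val + 1 := by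
  set γ := ofWindow (chosen c Q) hw with hγ
  have happ : ∀ k : Fin n, γ.1 (nat (k.val + 1) k.2) = chosen c Q k := fun k =>
    windowFun_nat _ _ _
  have hmem : ∀ k : Fin n, chosen c Q k ∈ Q := fun k =>
    remaining_anti c Q (Nat.zero_le _) (chosen_mem_remaining c hc hQ k)
  obtain ⟨p, rfl⟩ := γ.1.surjective x
  have hp := p.2
  rw [Set.mem_Icc] at hp
  rcases lt_trichotomy (p : ℤ) 0 with h | h | h
  · have he : p = -nat ((-(p : ℤ)).toNat - 1 + 1) (by omega) :=
      Subtype.ext (by rw [coe_neg, coe_nat]; omega)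
    rw [he, γ.2] at hx
    have h1 := happ ⟨(-(p : ℤ)).toNat - 1, by omega⟩
    rw [h1] at hx
    exact absurd hx ((hQ.2 _ fun h0 => hQ.1 (h0 ▸ hmem _)).mp (hmem _))
  · have he : p = 0 := Subtype.ext h
    rw [he, apply_zero] at hx
    exact absurd hx hQ.1
  · have he : p = nat ((p : ℤ).toNat - 1 + 1) (by omega) :=
      Subtype.ext (by rw [coe_nat]; omega)
    have h1 := happ ⟨(p : ℤ).toNat - 1, by omega⟩
    refine ⟨⟨(p : ℤ).toNat - 1, by omega⟩, ?_, ?_⟩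
    · rw [← h1]
      exact congrArg _ he.symm
    · rw [show γ.1⁻¹ (γ.1 p) = p from Equiv.Perm.inv_eq_iff_eq.mpr rfl]
      simp only
      omega

theorem remaining_of_chosen_lt (c : Finset (SInt n) → SInt n)
    (hc : ∀ Q : Finset (SInt n), Q.Nonempty → c Q ∈ Q) {Q : Finset (SInt n)} (hQ : IsHalf Q)
    (hw : IsWindow (chosen c Q)) {x y : SInt n} (hx : x ∈ Q) (hy : y ∈ Q)
    (hxy : (ofWindow (chosen c Q) hw).1⁻¹ x < (ofWindow (chosen c Q) hw).1⁻¹ y) :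
    ∃ R : Finset (SInt n), x ∈ R ∧ y ∈ R ∧ c R = x := by
  obtain ⟨i, hi, hi'⟩ := exists_chosen_eq c hc hQ hw hx
  obtain ⟨j, hj, hj'⟩ := exists_chosen_eq c hc hQ hw hy
  rw [← Subtype.coe_lt_coe, hi', hj'] at hxy
  refine ⟨remaining c Q i.val, ?_, ?_, hi⟩
  · rw [← hi]
    exact chosen_mem_remaining c hc hQ i
  · rw [← hj]
    exact remaining_anti c Q (by omega) (chosen_mem_remaining c hc hQ j)

namespace BnPoset

theorem lt_trans (P : BnPoset n) {x y z : SInt n} (h1 : P.lt x y) (h2 : P.lt y z) :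
    P.lt x z :=
  ⟨P.le_trans _ _ _ h1.1 h2.1, fun h => h1.2 (P.le_antisymm _ _ h1.1 (h ▸ h2.1))⟩

theorem lt_asymm (P : BnPoset n) {x y : SInt n} (h1 : P.lt x y) : ¬ P.lt y x :=
  fun h2 => (P.lt_trans h1 h2).2 rfl

theorem lt_neg_iff (P : BnPoset n) {x y : SInt n} : P.lt (-y) (-x) ↔ P.lt x y := by
  unfold lt
  rw [← P.le_neg, ne_eq, ne_eq, neg_inj', eq_comm]

end BnPoset

/-- The greedy algorithm, run with respect to a strict total order `r` of the integers that is
reversed by negation (in the application, `<` or `>`), produces the type-B linear extension of the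
regular poset `P` in which a pair `r x y` is inverted only if `P` forces it. -/
theorem greedy_lt_iff {P : BnPoset n} {r : SInt n → SInt n → Prop}
    (hirr : ∀ x, ¬ r x x) (htrans : ∀ x y z, r x y → r y z → r x z)
    (htot : ∀ x y, r x y ∨ x = y ∨ r y x) (hneg : ∀ x y, r x y → r (-y) (-x))
    (hreg : ∀ x y z, r x y → r y z →
      (P.lt x z → P.lt x y ∨ P.lt y z) ∧ (P.lt z x → P.lt z y ∨ P.lt y x))
    {c : Finset (SInt n) → SInt n}
    (hc : ∀ Q : Finset (SInt n), Q.Nonempty →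
      c Q ∈ P.minimals Q ∧ ∀ m ∈ P.minimals Q, m = c Q ∨ r (c Q) m)
    {Q : Finset (SInt n)} (hQ : IsHalf Q)
    (hmem : ∀ x, x ∈ Q ↔ P.lt 0 x ∨ r 0 x ∧ ¬ P.Comparable x 0)
    (hw : IsWindow (chosen c Q)) {x y : SInt n} (hxy : r x y) :
    (ofWindow (chosen c Q) hw).1⁻¹ y < (ofWindow (chosen c Q) hw).1⁻¹ x ↔ P.lt y x := by
  have hcm : ∀ Q : Finset (SInt n), Q.Nonempty → c Q ∈ Q := fun Q h =>
    (BnPoset.mem_minimals.mp (hc Q h).1).1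
  have hrem := fun {x y : SInt n} (hx : x ∈ Q) (hy : y ∈ Q) =>
    remaining_of_chosen_lt c hcm hQ hw hx hy
  have hpos : ∀ x ∈ Q, 0 < (((ofWindow (chosen c Q) hw).1⁻¹ x : SInt n) : ℤ) := fun x hx => by
    obtain ⟨k, -, hk⟩ := exists_chosen_eq c hcm hQ hw hx
    omega
  set γ := ofWindow (chosen c Q) hw
  have hposN : ∀ x, -x ∈ Q → ((γ.1⁻¹ x : SInt n) : ℤ) < 0 := fun x hx => by
    have := hpos _ hx
    rw [inv_apply_neg, coe_neg] at this
    omega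
  have hn0 : -(0 : SInt n) = 0 := BnPoset.neg_zero'
  have hγ0 : γ.1⁻¹ 0 = 0 := inv_apply_zero γ
  have hasym : ∀ x y, r x y → ¬ r y x := fun x y h h' => hirr x (htrans x y x h h')
  have hltneg : ∀ {x y : SInt n}, γ.1⁻¹ (-y) < γ.1⁻¹ (-x) ↔ γ.1⁻¹ x < γ.1⁻¹ y := by
    intro x y
    rw [inv_apply_neg, inv_apply_neg, ← Subtype.coe_lt_coe, ← Subtype.coe_lt_coe, coe_neg,
      coe_neg]
    omega
  have hr0 : ∀ x, r 0 (-x) → r x 0 := fun x h => by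
    simpa only [hn0, neg_neg'] using hneg 0 (-x) h
  have hP0 : ∀ x, P.lt x 0 ↔ P.lt 0 (-x) := fun x => by
    rw [← P.lt_neg_iff (x := x), hn0]
  have hpQ : ∀ x, P.lt 0 x → x ∈ Q := fun x h => (hmem x).mpr (Or.inl h)
  have hnQ : ∀ x, P.lt x 0 → -x ∈ Q := fun x h => hpQ _ ((hP0 x).mp h)
  have hdisj : ∀ x, x ∈ Q → -x ∉ Q := fun x hx =>
    (hQ.2 x fun h0 => hQ.1 (h0 ▸ hx)).mp hx
  -- If `y ∈ Q` is chosen while `x ∈ Q` remains and `r x y`, then some minimal `m` lies below `x`;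
  -- since `y` beats `m`, regularity applied to `x`, `y`, `m` puts `y` below `x`.
  have hQQ : ∀ x ∈ Q, ∀ y ∈ Q, r x y → γ.1⁻¹ y < γ.1⁻¹ x → P.lt y x := by
    classical
    intro x hx y hy hxy h
    obtain ⟨R, hyR, hxR, rfl⟩ := hrem hy hx h
    obtain ⟨hmin, hbest⟩ := hc R ⟨_, hyR⟩
    have hymin := (BnPoset.mem_minimals.mp hmin).2
    have hRx : (R.filter fun z => P.le z x).Nonempty :=
      ⟨x, Finset.mem_filter.mpr ⟨hxR, P.le_refl x⟩⟩
    obtain ⟨m, hm⟩ := P.minimals_nonempty hRx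
    obtain ⟨hmR, hmmin⟩ := BnPoset.mem_minimals.mp hm
    obtain ⟨hmR, hmx⟩ := Finset.mem_filter.mp hmR
    have hm' : m ∈ P.minimals R := BnPoset.mem_minimals.mpr ⟨hmR, fun z hz hzm =>
      hmmin z (Finset.mem_filter.mpr ⟨hz, P.le_trans _ _ _ hzm.1 hmx⟩) hzm⟩
    rcases hbest m hm' with rfl | hr
    · exact ⟨hmx, fun he => hirr x (by rwa [he] at hxy)⟩
    · have hmx' : P.lt m x := ⟨hmx, fun he => hasym _ _ hxy (he ▸ hr)⟩
      exact ((hreg _ _ _ hxy hr).2 hmx').resolve_left (hymin m hmR)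
  have hext : ∀ x y, P.lt y x → γ.1⁻¹ y < γ.1⁻¹ x := by
    have hQQ' : ∀ x ∈ Q, ∀ y ∈ Q, P.lt y x → γ.1⁻¹ y < γ.1⁻¹ x := by
      intro x hx y hy hyx
      rcases lt_trichotomy (γ.1⁻¹ y) (γ.1⁻¹ x) with h | h | h
      · exact h
      · exact absurd (γ.1⁻¹.injective h) hyx.2
      · obtain ⟨R, hxR, hyR, rfl⟩ := hrem hx hy h
        exact absurd hyx ((BnPoset.mem_minimals.mp (hc R ⟨_, hxR⟩).1).2 y hyR)
    intro x y h
    rcases eq_zero_or_neg_mem hQ x with hx | rfl | hx <;>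
      rcases eq_zero_or_neg_mem hQ y with hy | rfl | hy
    · exact hQQ' x hx y hy h
    · rw [hγ0]
      exact hpos x hx
    · exact (show ((γ.1⁻¹ y : SInt n) : ℤ) < _ from (hposN y hy).trans (hpos x hx))
    · exact absurd (hnQ y h) (hdisj y hy)
    · exact absurd rfl h.2
    · rw [hγ0]
      exact hposN y hy
    · -- Otherwise `P` would place an element of `Q` below an element of `-Q`, and then, by
      -- regularity applied around `0`, one of the two on the wrong side of `0`.
      have hxQ : x ∉ Q := fun h' => hdisj x h' hx
      have hx0 : ¬ P.lt x 0 := fun h' => hdisj y hy (hnQ y (P.lt_trans h h'))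
      have hy0 : ¬ P.lt 0 y := fun h' => hxQ (hpQ x (P.lt_trans h' h))
      have hry : r 0 y := (((hmem y).mp hy).resolve_left hy0).1
      have hrx : r x 0 := hr0 x
        (((hmem (-x)).mp hx).resolve_left fun h' => hx0 ((hP0 x).mpr h')).1
      rcases (hreg x 0 y hrx hry).2 h with h' | h'
      · exact absurd (hnQ y h') (hdisj y hy)
      · exact absurd (hpQ x h') hxQ
    · exact absurd (hpQ x h) fun h' => hdisj x h' hx
    · exact hltneg.mp (hQQ' _ hy _ hx (P.lt_neg_iff.mpr h))
  refine ⟨fun h => ?_, hext x y⟩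
  have hx0 : x ∈ Q → r x 0 → P.lt 0 x := fun hx hr =>
    ((hmem x).mp hx).resolve_right fun h' => hasym _ _ hr h'.1
  have hy0 : -y ∈ Q → r 0 y → P.lt y 0 := fun hy hr => (hP0 y).mpr
    (((hmem (-y)).mp hy).resolve_right fun h' => hasym _ _ hr (hr0 y h'.1))
  rw [← Subtype.coe_lt_coe] at h
  rcases eq_zero_or_neg_mem hQ x with hx | rfl | hx <;>
    rcases eq_zero_or_neg_mem hQ y with hy | rfl | hy
  · exact hQQ x hx y hy hxy h
  · exact hx0 hx hxy
  · rcases htot x 0 with hrx | rfl | hrx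
    · rcases htot y 0 with hry | rfl | hry
      · exact ((hreg x y 0 hxy hry).2 (hx0 hx hrx)).resolve_left fun h' =>
          hdisj y (hpQ y h') hy
      · exact hx0 hx hrx
      · exact P.lt_trans (hy0 hy hry) (hx0 hx hrx)
    · exact absurd hx hQ.1
    · exact ((hreg 0 x y hrx hxy).2 (hy0 hy (htrans _ _ _ hrx hxy))).resolve_right fun h' =>
        hdisj x hx (hnQ x h')
  · rw [hγ0] at h
    exact absurd (hpos y hy) (not_lt_of_ge h.le)
  · exact absurd h (lt_irrefl _)
  · exact hy0 hy hxy
  · exact absurd ((hposN x hx).trans (hpos y hy)) (not_lt_of_ge h.le)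
  · rw [hγ0] at h
    exact absurd (hposN x hx) (not_lt_of_ge h.le)
  · exact P.lt_neg_iff.mp (hQQ _ hy _ hx (hneg x y hxy) (hltneg.mpr h))

namespace BnPoset

theorem sigma_lt_iff {P : BnPoset n} (hP : P.IsRegular) {x y : SInt n} (hxy : x < y) :
    P.sigma.1⁻¹ y < P.sigma.1⁻¹ x ↔ P.lt y x := by
  refine greedy_lt_iff (P := P) (r := (· < ·)) (fun _ => lt_irrefl _)
    (fun _ _ _ => _root_.lt_trans) lt_trichotomy ?_ hP.2 ?_ P.isHalf_initQ₁ ?_ _ hxy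
  · intro x y h
    rw [← Subtype.coe_lt_coe] at h ⊢
    rw [coe_neg, coe_neg]
    omega
  · intro R hR
    rw [chooseSmallest, dif_pos hR]
    exact ⟨Finset.min'_mem _ _, fun m hm => (Finset.min'_le _ m hm).eq_or_lt.imp Eq.symm id⟩
  · intro x
    simp [initQ₁]

theorem rho_lt_iff {P : BnPoset n} (hP : P.IsRegular) {x y : SInt n} (hxy : x < y) :
    P.rho.1⁻¹ x < P.rho.1⁻¹ y ↔ P.lt x y := by
  refine greedy_lt_iff (P := P) (r := (· > ·)) (fun _ => lt_irrefl _)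
    (fun _ _ _ h1 h2 => _root_.lt_trans h2 h1) (fun x y => (lt_trichotomy y x).imp id
      (Or.imp Eq.symm id)) ?_ ?_ ?_ P.isHalf_initQ₂ ?_ _ hxy
  · intro x y h
    change y < x at h
    change -x < -y
    rw [← Subtype.coe_lt_coe] at h ⊢
    rw [coe_neg, coe_neg]
    omega
  · intro x y z h1 h2
    have := hP.2 z y x h2 h1
    tauto
  · intro R hR
    rw [chooseLargest, dif_pos hR]
    exact ⟨Finset.max'_mem _ _, fun m hm => (Finset.le_max' _ m hm).eq_or_lt⟩
  · intro x
    simp [initQ₂]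

end BnPoset

/-! ### Regular posets and intervals -/

theorem mem_weakInterval_iff {σ ρ γ : SignedPerm n} :
    γ ∈ weakInterval σ ρ ↔ ∀ x y : SInt n, x < y →
      (σ.1⁻¹ y < σ.1⁻¹ x → γ.1⁻¹ y < γ.1⁻¹ x) ∧ (ρ.1⁻¹ x < ρ.1⁻¹ y → γ.1⁻¹ x < γ.1⁻¹ y) := by
  have hflip : ∀ {x y : SInt n}, x < y → ∀ w : SignedPerm n,
      (w.1⁻¹ x < w.1⁻¹ y ↔ ¬ w.1⁻¹ y < w.1⁻¹ x) := fun {x y} h w =>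
    ⟨lt_asymm, fun h' => lt_of_le_of_ne (not_lt.mp h') fun he =>
      h.ne (w.1⁻¹.injective he)⟩
  change WeakLE σ γ ∧ WeakLE γ ρ ↔ _
  rw [weakLE_iff, weakLE_iff]
  constructor
  · rintro ⟨h1, h2⟩ x y hxy
    refine ⟨h1 x y hxy, ?_⟩
    rw [hflip hxy, hflip hxy]
    exact mt (h2 x y hxy)
  · intro h
    refine ⟨fun x y hxy => (h x y hxy).1, fun x y hxy => ?_⟩
    have := (h x y hxy).2
    rw [hflip hxy, hflip hxy] at this
    exact not_imp_not.mp this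

theorem mem_signedExtensions_iff {P : BnPoset n} {γ : SignedPerm n} :
    γ ∈ signedExtensions P ↔ ∀ x y : SInt n, x < y →
      (P.lt y x → γ.1⁻¹ y < γ.1⁻¹ x) ∧ (P.lt x y → γ.1⁻¹ x < γ.1⁻¹ y) := by
  have hlt : ∀ {x y : SInt n}, γ.1⁻¹ x ≤ γ.1⁻¹ y → x ≠ y → γ.1⁻¹ x < γ.1⁻¹ y :=
    fun h hne => lt_of_le_of_ne h fun he => hne (γ.1⁻¹.injective he)
  constructor
  · rintro ⟨-, h⟩ x y -
    exact ⟨fun hP => hlt (h y x hP.1) hP.2, fun hP => hlt (h x y hP.1) hP.2⟩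
  · refine fun h => ⟨fun x y => le_total _ _, fun x y hP => ?_⟩
    rcases lt_trichotomy x y with hxy | rfl | hxy
    · exact ((h x y hxy).2 ⟨hP, hxy.ne⟩).le
    · exact le_rfl
    · exact ((h y x hxy).1 ⟨hP, hxy.ne'⟩).le

/-- For `σ ≤ ρ` in the weak order, the intersection of the two linear orders reverses a pair of
integers exactly when `σ` does, and preserves it exactly when `ρ` does. -/
theorem posetOf_pair_lt_iff {σ ρ : SignedPerm n} (h : WeakLE σ ρ) {x y : SInt n} (hxy : x < y) :
    ((posetOf {σ, ρ} (Set.insert_nonempty σ {ρ})).lt y x ↔ σ.1⁻¹ y < σ.1⁻¹ x) ∧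
    ((posetOf {σ, ρ} (Set.insert_nonempty σ {ρ})).lt x y ↔ ρ.1⁻¹ x < ρ.1⁻¹ y) := by
  rw [weakLE_iff] at h
  have hne : ∀ w : SignedPerm n, w.1⁻¹ x ≠ w.1⁻¹ y := fun w he => hxy.ne (w.1⁻¹.injective he)
  have hle : ∀ a b : SInt n, (posetOf {σ, ρ} (Set.insert_nonempty σ {ρ})).le a b ↔
      σ.1⁻¹ a ≤ σ.1⁻¹ b ∧ ρ.1⁻¹ a ≤ ρ.1⁻¹ b := fun a b => by
    simp [posetOf, linearPoset]
  unfold BnPoset.lt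
  rw [hle, hle]
  constructor
  · exact ⟨fun h' => lt_of_le_of_ne h'.1.1 (hne σ).symm,
      fun h' => ⟨⟨h'.le, (h x y hxy h').le⟩, hxy.ne'⟩⟩
  · refine ⟨fun h' => lt_of_le_of_ne h'.1.2 (hne ρ), fun h' => ⟨⟨?_, h'.le⟩, hxy.ne⟩⟩
    exact not_lt.mp fun hσ => lt_asymm h' (h x y hxy hσ)

theorem posetOf_isDistinguished (U : Set (SignedPerm n)) (hU : U.Nonempty) :
    (posetOf U hU).IsDistinguished := by
  have key : ∀ (γ : SignedPerm n) (x : SInt n),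
      (γ.1⁻¹ x ≤ γ.1⁻¹ (-x) → γ.1⁻¹ x ≤ γ.1⁻¹ 0) ∧
      (γ.1⁻¹ (-x) ≤ γ.1⁻¹ x → γ.1⁻¹ 0 ≤ γ.1⁻¹ x) := fun γ x => by
    rw [inv_apply_zero, inv_apply_neg, ← Subtype.coe_le_coe, ← Subtype.coe_le_coe,
      ← Subtype.coe_le_coe, ← Subtype.coe_le_coe, coe_neg, coe_zero]
    omega
  intro x hx
  have hx0 : (posetOf U hU).Comparable x 0 := hx.imp
    (fun h γ hγ => (key γ x).1 (h γ hγ)) (fun h γ hγ => (key γ x).2 (h γ hγ))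
  refine ⟨hx0, hx0.symm.imp (fun h => ?_) (fun h => ?_)⟩
  · exact (BnPoset.zero_le_iff _ _).mp h
  · exact (BnPoset.le_zero_iff _ _).mp h

theorem posetOf_pair_isRegular {σ ρ : SignedPerm n} (h : WeakLE σ ρ) :
    (posetOf {σ, ρ} (Set.insert_nonempty σ {ρ})).IsRegular := by
  refine ⟨posetOf_isDistinguished _ _, fun x y z hxy hyz => ?_⟩
  have h1 := posetOf_pair_lt_iff h hxy
  have h2 := posetOf_pair_lt_iff h hyz
  have h3 := posetOf_pair_lt_iff h (hxy.trans hyz)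
  rw [h1.1, h1.2, h2.1, h2.2, h3.1, h3.2]
  exact ⟨fun hlt => (lt_or_ge _ _).imp_right fun hle => hle.trans_lt hlt,
    fun hlt => (lt_or_ge _ _).imp_right fun hle => hle.trans_lt hlt⟩

end TypeB

theorem theorem4 (n : ℕ) :
    (∀ P : TypeB.BnPoset n, P.IsRegular →
      TypeB.WeakLE P.sigma P.rho ∧
      TypeB.signedExtensions P = TypeB.weakInterval P.sigma P.rho) ∧
    (∀ σ ρ : TypeB.SignedPerm n, TypeB.WeakLE σ ρ →
      (TypeB.posetOf {σ, ρ} (Set.insert_nonempty σ {ρ})).IsRegular ∧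
      TypeB.signedExtensions (TypeB.posetOf {σ, ρ} (Set.insert_nonempty σ {ρ})) =
        TypeB.weakInterval σ ρ) := by
  refine ⟨fun P hP => ⟨?_, Set.ext fun γ => ?_⟩,
    fun σ ρ h => ⟨TypeB.posetOf_pair_isRegular h, Set.ext fun γ => ?_⟩⟩
  · refine TypeB.weakLE_iff.mpr fun x y hxy h => ?_
    rw [TypeB.BnPoset.sigma_lt_iff hP hxy] at h
    refine lt_of_not_ge fun hle => P.lt_asymm h ?_
    exact (TypeB.BnPoset.rho_lt_iff hP hxy).mp
      (lt_of_le_of_ne hle fun he => hxy.ne (P.rho.1⁻¹.injective he))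
  · rw [TypeB.mem_signedExtensions_iff, TypeB.mem_weakInterval_iff]
    refine forall₃_congr fun x y hxy => ?_
    rw [TypeB.BnPoset.sigma_lt_iff hP hxy, TypeB.BnPoset.rho_lt_iff hP hxy]
  · rw [TypeB.mem_signedExtensions_iff, TypeB.mem_weakInterval_iff]
    refine forall₃_congr fun x y hxy => ?_
    rw [(TypeB.posetOf_pair_lt_iff h hxy).1, (TypeB.posetOf_pair_lt_iff h hxy).2]
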